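/- **Conventions.** A metric measure space $(X,d,\mu)$ is a separable metric space with a locally finite Borel regular (outer) measure $\mu$ such that $\mu(V)=\sup\{\mu(K):K\subseteq V\text{ compact}\}$ for open $V$. For a distance $D$ on $X$, a map $g$ from $X$ to a metric space and $x\in A\subseteq X$, let $\operatorname{Lip}_D(g|_A;x)=\limsup_{A\ni y\to x,\,y\neq x} d(g(x),g(y))/D(x,y)$, which is $0$ if $x$ is isolated in $A$. Put $D(A,x)=\inf_{a\in A}D(a,x)$ (with $\inf\varnothing=\infty$), $B_D(A,r)=\{x: D(A,x)\le r\}$, $U_D(A,r)=\{x:D(A,x)<r\}$. A set $E\subseteq X$ is porous w.r.t. $D$ if for each $x\in E$ there are $\epsilon>0$ and $y_i\to x$ with $E\cap B_D(y_i,\epsilon D(x,y_i))=\varnothing$ for all $i$. Let $Y$ be a real Banach space. For $\varphi:X\to\mathbb R^n$, a map $f:X\to Y$ is $\varphi$-differentiable at $x$ w.r.t. $D$ if there is a unique linear $T:\mathbb R^n\to Y$ with $\operatorname{Lip}_D(f-T\circ\varphi;x)=0$; $T$ is then the Cheeger differential. A Cheeger atlas of $(X,d,\mu)$ is a countable family $\{(U_j,\varphi_j:X\to\mathbb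 R^{n_j})\}_j$ ($n_j\ge 0$) with $U_j$ $\mu$-measurable, $\varphi_j$ $d$-Lipschitz, $\mu(X\setminus\bigcup_jU_j)=0$, such that every $d$-Lipschitz $f:X\to Y$ is $\varphi_j$-differentiable w.r.t. $d$ at $\mu$-a.e. $x\in U_j$, for every $j$. A $Y$-LDS is a metric measure space that has a Cheeger atlas. $(X,d)$ has shortcuts $\{(\mathcal J_i,\delta_i)\}_i$ if $\delta_i>0$, $\delta_i\to0$, each $\mathcal J_i$ is a non-empty family of disjoint subsets of $X$, and there are constants $a,a_0,b,M>0$ such that, for all $i$ and $S\in\mathcal J_i$: $a_0\delta_i\le d(x,y)\le a\delta_i$ for distinct $x,y\in S$; $d(S,S')\ge b\delta_j$ for $S'\in\mathcal J_j$, $S'\ne S$, $i\le j$; $d(x,y)\le d(x,z)+d(w,y)$ for $x,y\notin U_d(S,b\delta_i)$ and $z,w\in S$; $2\le\#S\le M$; and $B_d(\bigcup\mathcal J_i,M\delta_i)=X$. A Cheeger atlas is compatible with the shortcuts if every $\varphi_j$ is constant on every $S\in\bigcup_i\mathcal J_i$; $(X,d,\mu)$ is a $Y$-LDS with compatible shortcuts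 if it is a $Y$-LDS, has shortcuts, and has a compatible atlas. Given $\eta_i\in(0,1]$, put $\rho_\eta(x,y)=\eta_i d(x,y)$ if $x,y\in S\in\mathcal J_i$ (the least such value, should $S$ belong to several $\mathcal J_i$) and $\rho_\eta(x,y)=d(x,y)$ otherwise; $d_\eta(x,y)$ is the infimum of $\sum_{k=1}^n\rho_\eta(x_{k-1},x_k)$ over finite chains $x=x_0,\dots,x_n=y$. For $f:X\to Y$ and $\epsilon>0$ let $\mathcal J_i^\epsilon(f)=\{S\in\mathcal J_i:\operatorname{diam}f(S)\ge\epsilon\eta_i\delta_i\}$ and $$\operatorname{Bad}(f)=\bigcup_{\epsilon>0}\limsup_{i\to\infty}B_{d_\eta}\Big(\bigcup\mathcal J_i^\epsilon(f),\,\eta_i\delta_i/\epsilon\Big).$$ **Theorem.** Let $Y$ be a real Banach space, $(X,d,\mu)$ a $Y$-LDS with compatible shortcuts $\{(\mathcal J_i,\delta_i)\}_i$, let $\eta=(\eta_i)\subseteq(0,1]$, and suppose that $\mu(E)=0$ for every $E\subseteq X$ porous w.r.t. $d_\eta$. Let $f:(X,d_\eta)\to Y$ be Lipschitz and let $\{(U_j,\varphi_j)\}_j$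 be any compatible atlas. Then, for every $j$: 1. $f$ is $\varphi_j$-differentiable w.r.t. $d_\eta$ at $\mu$-a.e. $x\in U_j\setminus\operatorname{Bad}(f)$; 2. for every $A\subseteq\operatorname{Bad}(f)$ (measurable or not), neither $f$ nor its restriction to $(A,d_\eta)$ is $\varphi_j$-differentiable at $\mu$-a.e. $x\in A\cap U_j$; precisely, for $\mu$-a.e. $x\in A\cap U_j$ and every linear $T:\mathbb R^{n_j}\to Y$, $\operatorname{Lip}_{d_\eta}(f-T\circ\varphi_j;x)>0$ and $\operatorname{Lip}_{d_\eta}((f-T\circ\varphi_j)|_A;x)>0$; 3. at $\mu$-a.e. $x\in U_j\setminus\operatorname{Bad}(f)$ the $\varphi_j$-differentials of $f$ w.r.t. $d$ and w.r.t. $d_\eta$ both exist and agree. -/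

import Mathlib

open Set Filter Topology MeasureTheory

noncomputable section

namespace Shortcut

/-! ### Metric notions relative to a distance function

The same set `X` carries two distances, so the metric notions below take the distance
`D : X → X → ℝ` as an explicit argument. -/

section Metric

variable {X : Type*} {Z : Type*} [PseudoMetricSpace Z]

/-- `f : (X, D) → Z` is Lipschitz. -/
def IsLipschitz (D : X → X → ℝ) (f : X → Z) : Prop :=
  ∃ L : ℝ, 0 ≤ L ∧ ∀ x y, dist (f x) (f y) ≤ L * D x y

/-- The pointwise Lipschitz constant `Lip(f|_A; x)`, for `x ∈ A`, of the restriction of `f` to the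
subspace `A` of `(X, D)`: the limsup of `dist (f x) (f y) / D x y` as `y → x` with `y ∈ A`, `y ≠ x`.
It is `0` when `x` is an isolated point of `A` (the filter is then trivial). -/
def lipAtWithin (D : X → X → ℝ) (A : Set X) (f : X → Z) (x : X) : ENNReal :=
  limsup (fun y => ENNReal.ofReal (dist (f x) (f y) / D x y))
    (comap (D x) (𝓝[>] (0 : ℝ)) ⊓ 𝓟 A)

/-- The pointwise Lipschitz constant `Lip(f; x)` on `(X, D)`. -/
def lipAt (D : X → X → ℝ) (f : X → Z) (x : X) : ENNReal :=
  lipAtWithin D univ f x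

/-- Distance from a set to a point; it is `∞` for the empty set. -/
def setDist (D : X → X → ℝ) (A : Set X) (x : X) : ENNReal :=
  ⨅ a ∈ A, ENNReal.ofReal (D a x)

/-- The closed neighbourhood `B(A, r)`; it is empty if `A` is. -/
def closedNhd (D : X → X → ℝ) (A : Set X) (r : ℝ) : Set X :=
  {x | setDist D A x ≤ ENNReal.ofReal r}

/-- The open neighbourhood `U(A, r)`. -/
def openNhd (D : X → X → ℝ) (A : Set X) (r : ℝ) : Set X :=
  {x | setDist D A x < ENNReal.ofReal r}

/-- `E` is porous at `x` with respect to `D`. -/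
def IsPorousAt (D : X → X → ℝ) (E : Set X) (x : X) : Prop :=
  ∃ ε : ℝ, 0 < ε ∧ ∃ y : ℕ → X, Tendsto (fun i => D x (y i)) atTop (𝓝 0) ∧
    ∀ i, E ∩ closedNhd D {y i} (ε * D x (y i)) = ∅

/-- `E` is porous (at each of its points) with respect to `D`. -/
def IsPorous (D : X → X → ℝ) (E : Set X) : Prop :=
  ∀ x ∈ E, IsPorousAt D E x

end Metric

/-! ### Cheeger differentials and Lipschitz differentiability spaces -/

section Cheeger

variable {X : Type*} {Y : Type*} [NormedAddCommGroup Y] [NormedSpace ℝ Y]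

/-- `T` is the `φ`-differential at `x` of the restriction of `f` to the subspace `A` of `(X, D)`:
the unique linear map with `Lip((f - T ∘ φ)|_A; x) = 0`. -/
def IsCheegerDifferentialWithin (D : X → X → ℝ) (A : Set X) {n : ℕ}
    (φ : X → EuclideanSpace ℝ (Fin n)) (f : X → Y) (x : X)
    (T : EuclideanSpace ℝ (Fin n) →ₗ[ℝ] Y) : Prop :=
  lipAtWithin D A (fun y => f y - T (φ y)) x = 0 ∧
    ∀ T' : EuclideanSpace ℝ (Fin n) →ₗ[ℝ] Y,
      lipAtWithin D A (fun y => f y - T' (φ y)) x = 0 → T' = T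

/-- `T` is the `φ`-differential of `f` at `x` on `(X, D)`. -/
def IsCheegerDifferential (D : X → X → ℝ) {n : ℕ}
    (φ : X → EuclideanSpace ℝ (Fin n)) (f : X → Y) (x : X)
    (T : EuclideanSpace ℝ (Fin n) →ₗ[ℝ] Y) : Prop :=
  IsCheegerDifferentialWithin D univ φ f x T

/-- A countable collection of pairs `(U_i, φ_i : X → ℝ^{n_i})`. -/
structure ChartFamily (X : Type*) where
  ι : Type
  countable : Countable ι
  U : ι → Set X
  dim : ι → ℕ
  φ : (i : ι) → X → EuclideanSpace ℝ (Fin (dim i))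

/-- `𝒜` is a Cheeger atlas of `(X, D, μ)` for maps with values in `Y`. For the σ-finite Borel
regular measures considered, null-measurable is the same as Carathéodory measurable. -/
def IsCheegerAtlas [MeasurableSpace X] (Y : Type*) [NormedAddCommGroup Y] [NormedSpace ℝ Y]
    (D : X → X → ℝ) (μ : Measure X) (𝒜 : ChartFamily X) : Prop :=
  (∀ i, NullMeasurableSet (𝒜.U i) μ) ∧
  (∀ i, IsLipschitz D (𝒜.φ i)) ∧
  μ (⋃ i, 𝒜.U i)ᶜ = 0 ∧
  ∀ f : X → Y, IsLipschitz D f → ∀ i, ∀ᵐ x ∂μ, x ∈ 𝒜.U i →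
    ∃ T, IsCheegerDifferential D (𝒜.φ i) f x T

/-- Metric measure space: a separable metric space with a locally finite measure that is inner
regular by compact sets on open sets. A Mathlib measure on the Borel σ-algebra, evaluated on
arbitrary sets, is exactly a Borel regular outer measure. -/
def IsMetricMeasureSpace [MetricSpace X] [MeasurableSpace X] (μ : Measure X) : Prop :=
  BorelSpace X ∧ TopologicalSpace.SeparableSpace X ∧ IsLocallyFiniteMeasure μ ∧
    μ.InnerRegularWRT IsCompact IsOpen

/-- `(X, d, μ)` is a `Y`-Lipschitz differentiability space. -/
def IsLDS [MetricSpace X] [MeasurableSpace X] (Y : Type*) [NormedAddCommGroup Y]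
    [NormedSpace ℝ Y] (μ : Measure X) : Prop :=
  IsMetricMeasureSpace μ ∧ ∃ 𝒜 : ChartFamily X, IsCheegerAtlas Y dist μ 𝒜

end Cheeger

/-! ### Shortcuts and the shortcut distance -/

section Shortcuts

variable {X : Type*} [MetricSpace X]

/-- The metric space `X` has shortcuts `{(J i, δ i)}_i`. -/
def HasShortcuts (J : ℕ → Set (Set X)) (δ : ℕ → ℝ) : Prop :=
  (∀ i, 0 < δ i) ∧ Tendsto δ atTop (𝓝 0) ∧
  (∀ i, (J i).Nonempty) ∧ (∀ i, (J i).PairwiseDisjoint id) ∧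
  ∃ a a₀ b M : ℝ, 0 < a ∧ 0 < a₀ ∧ 0 < b ∧ 0 < M ∧
    (∀ i, ∀ S ∈ J i, ∀ x ∈ S, ∀ y ∈ S, x ≠ y → a₀ * δ i ≤ dist x y ∧ dist x y ≤ a * δ i) ∧
    (∀ i j, i ≤ j → ∀ S ∈ J i, ∀ S' ∈ J j, S ≠ S' →
      ∀ x ∈ S, ∀ y ∈ S', b * δ j ≤ dist x y) ∧
    (∀ i, ∀ S ∈ J i, ∀ x ∉ openNhd dist S (b * δ i), ∀ y ∉ openNhd dist S (b * δ i),
      ∀ z ∈ S, ∀ w ∈ S, dist x y ≤ dist x z + dist w y) ∧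
    (∀ i, ∀ S ∈ J i, S.Finite ∧ 2 ≤ S.ncard ∧ (S.ncard : ℝ) ≤ M) ∧
    (∀ i, closedNhd dist (⋃₀ J i) (M * δ i) = univ)

open Classical in
/-- `ρ_η(x, y)` is `η i * d(x, y)` if `x, y ∈ S ∈ J i`, and `d(x, y)` otherwise. If a shortcut
happens to belong to several `J i`, the least of the corresponding values is taken. -/
def rho (J : ℕ → Set (Set X)) (η : ℕ → ℝ) (x y : X) : ℝ :=
  if ∃ i, ∃ S ∈ J i, x ∈ S ∧ y ∈ S then
    sInf {c | ∃ i, ∃ S ∈ J i, x ∈ S ∧ y ∈ S ∧ c = η i * dist x y}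
  else dist x y

/-- The shortcut distance `d_η`: the infimum of the `ρ_η`-lengths of the chains
`x = p 0, p 1, …, p (n + 1) = y`. -/
def shortcutDist (J : ℕ → Set (Set X)) (η : ℕ → ℝ) (x y : X) : ℝ :=
  sInf {c | ∃ (n : ℕ) (p : ℕ → X), p 0 = x ∧ p (n + 1) = y ∧
    c = ∑ k ∈ Finset.range (n + 1), rho J η (p k) (p (k + 1))}

/-- A Cheeger atlas of `(X, d, μ)` compatible with the shortcuts: every chart map is constant on
every shortcut. -/
def IsCompatibleAtlas [MeasurableSpace X] (Y : Type*) [NormedAddCommGroup Y] [NormedSpace ℝ Y]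
    (μ : Measure X) (J : ℕ → Set (Set X)) (𝒜 : ChartFamily X) : Prop :=
  IsCheegerAtlas Y dist μ 𝒜 ∧ ∀ j, ∀ i, ∀ S ∈ J i, Metric.diam (𝒜.φ j '' S) = 0

/-- `(X, d, μ)` is a `Y`-LDS with compatible shortcuts `{(J i, δ i)}_i`. -/
def IsLDSWithCompatibleShortcuts [MeasurableSpace X] (Y : Type*) [NormedAddCommGroup Y]
    [NormedSpace ℝ Y] (μ : Measure X) (J : ℕ → Set (Set X)) (δ : ℕ → ℝ) : Prop :=
  IsLDS Y μ ∧ HasShortcuts J δ ∧ ∃ 𝒜 : ChartFamily X, IsCompatibleAtlas Y μ J 𝒜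

variable {Y : Type*} [NormedAddCommGroup Y]

/-- The shortcuts `S ∈ J i` with `diam f(S) ≥ ε η_i δ_i`. -/
def largeShortcuts (J : ℕ → Set (Set X)) (δ η : ℕ → ℝ) (f : X → Y) (ε : ℝ) (i : ℕ) :
    Set (Set X) :=
  {S ∈ J i | ε * η i * δ i ≤ Metric.diam (f '' S)}

/-- `Bad_ε(f)`. -/
def badEps (J : ℕ → Set (Set X)) (δ η : ℕ → ℝ) (f : X → Y) (ε : ℝ) : Set X :=
  limsup (fun i => closedNhd (shortcutDist J η) (⋃₀ largeShortcuts J δ η f ε i)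
    (η i * δ i / ε)) atTop

/-- `Bad(f)`. -/
def bad (J : ℕ → Set (Set X)) (δ η : ℕ → ℝ) (f : X → Y) : Set X :=
  ⋃ (ε : ℝ) (_ : 0 < ε), badEps J δ η f ε

end Shortcuts

end Shortcut

end

namespace Shortcut

/-! ### The pointwise Lipschitz constant and porosity -/

section Metric

variable {X : Type*} {Z : Type*} [PseudoMetricSpace Z]

/-! Up to a constant, `shortcutDist` is realized by going from `x` to a point `z` of one shortcut,
jumping to `w` in the same shortcut, and going on to `y` (`exists_dist_le_or_jump`). So first-order
behaviour for `d_η` is first-order behaviour for `d` plus the oscillation on nearby shortcuts. The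
charts are constant on shortcuts, so `g = f - T ∘ φ` oscillates there exactly as `f` does.

Outside `bad`, the oscillation of `f` on a shortcut is negligible compared with the `d_η`-distance
travelled (`exists_osc_le_of_notMem_badEps`). Smallness of `g` at `x` for `d` covers the stretch
from `x` to `z`, but says nothing about the stretch from `w` to `y`, since `w` may be `d`-far from
`x`. Non-porosity of `slowSet` supplies a point `u`, `d_η`-close to `y`, at which `g` is also slow
at a uniform scale; `exists_dist_le_or_jump_near` locates `u` relative to the jump. The differential
`T` depends on the point while only countably many null sets can be discarded, so `T` is replaced by
members of a countable family (`exists_countable_approx_differential`). Uniqueness passes from `d`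
to `d_η` because `d_η ≤ d`.

Inside `bad`, large shortcuts occur arbitrarily close to `x`. If `g` had zero Lipschitz constant
along `A`, non-porosity would place points of `A` near every point of such a shortcut, forcing `g`,
hence `f`, to oscillate too little on it (`lipAtWithin_pos_of_not_isPorousAt`).

The points at which any given set is porous form a porous set, which is null by hypothesis;
measurability of the set plays no role. -/

theorem lipAtWithin_eq_zero_iff {D : X → X → ℝ} {A : Set X} {g : X → Z} {x : X} :
    lipAtWithin D A g x = 0 ↔ ∀ ε : ℝ, 0 < ε → ∃ r : ℝ, 0 < r ∧
      ∀ y ∈ A, 0 < D x y → D x y < r → dist (g x) (g y) ≤ ε * D x y := by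
  have basis : (comap (D x) (𝓝[>] (0 : ℝ)) ⊓ 𝓟 A).HasBasis (fun r : ℝ => 0 < r)
      (fun r => (D x ⁻¹' Ioo 0 r) ∩ A) :=
    ((nhdsGT_basis (0 : ℝ)).comap (D x)).inf_principal A
  constructor
  · intro h ε hε
    have hlt : lipAtWithin D A g x < ENNReal.ofReal ε := by
      rw [h]; exact ENNReal.ofReal_pos.2 hε
    obtain ⟨r, hr, hr'⟩ := basis.eventually_iff.1 (eventually_lt_of_limsup_lt hlt)
    refine ⟨r, hr, fun y hy h0 h1 => ?_⟩
    have := (hr' ⟨⟨h0, h1⟩, hy⟩).le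
    rw [ENNReal.ofReal_le_ofReal_iff hε.le, div_le_iff₀ h0] at this
    exact this
  · intro h
    refine le_antisymm (le_of_forall_gt fun c hc => ?_) bot_le
    obtain ⟨q, hq0, hqc⟩ := ENNReal.lt_iff_exists_real_btwn.1 hc
    have hq : 0 < q := ENNReal.ofReal_pos.1 hqc.1
    obtain ⟨r, hr, hr'⟩ := h q hq
    refine lt_of_le_of_lt (limsup_le_of_le (a := ENNReal.ofReal q) (by isBoundedDefault) ?_) hqc.2
    refine basis.eventually_iff.2 ⟨r, hr, fun y hy => ?_⟩
    refine ENNReal.ofReal_le_ofReal ?_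
    rw [div_le_iff₀ hy.1.1]
    exact hr' y hy.2 hy.1.1 hy.1.2

theorem lipAtWithin_mono {D : X → X → ℝ} {A B : Set X} (h : A ⊆ B) (g : X → Z) (x : X) :
    lipAtWithin D A g x ≤ lipAtWithin D B g x :=
  limsup_le_limsup_of_le (inf_le_inf_left _ (principal_mono.2 h))

theorem mem_closedNhd_singleton {D : X → X → ℝ} {y u : X} {r : ℝ} (hr : 0 ≤ r) :
    u ∈ closedNhd D {y} r ↔ D y u ≤ r := by
  simp [closedNhd, setDist, ENNReal.ofReal_le_ofReal_iff hr]

/-- At a point where `E` is not porous, `E` is relatively dense at small scales. -/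
theorem exists_mem_of_not_isPorousAt {D : X → X → ℝ} (hD : ∀ x y, 0 ≤ D x y) {E : Set X} {x : X}
    (h : ¬ IsPorousAt D E x) {ε : ℝ} (hε : 0 < ε) :
    ∃ r : ℝ, 0 < r ∧ ∀ y, D x y < r → ∃ u ∈ E, D y u ≤ ε * D x y := by
  by_contra! hc
  refine h ⟨ε, hε, ?_⟩
  choose y hy hy' using fun i : ℕ => hc (1 / ((i : ℝ) + 1)) (by positivity)
  refine ⟨y, squeeze_zero (fun i => hD _ _) (fun i => (hy i).le)
    tendsto_one_div_add_atTop_nhds_zero_nat, fun i => ?_⟩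
  ext u
  simp only [mem_inter_iff, mem_empty_iff_false, iff_false, not_and]
  intro hu hu'
  rw [mem_closedNhd_singleton (mul_nonneg hε.le (hD _ _))] at hu'
  exact absurd hu' (not_le.2 (hy' i u hu))

/-- The set of points of `E` at which `E` is porous is porous. -/
theorem isPorous_porousPoints (D : X → X → ℝ) (E : Set X) :
    IsPorous D {x ∈ E | IsPorousAt D E x} := by
  rintro x ⟨-, ε, hε, y, hy, hE⟩
  refine ⟨ε, hε, y, hy, fun i => ?_⟩
  rw [← subset_empty_iff, ← hE i]
  exact inter_subset_inter_left _ (sep_subset _ _)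

end Metric

/-! ### The shortcut distance as an infimum over chains -/

section Chains

variable {X : Type*} [MetricSpace X] {J : ℕ → Set (Set X)} {η : ℕ → ℝ}

theorem rho_symm (x y : X) : rho J η x y = rho J η y x := by
  classical
  unfold rho
  refine if_congr ?_ ?_ (dist_comm x y)
  · simp only [and_comm (a := x ∈ _)]
  · simp only [dist_comm x y, and_left_comm (a := x ∈ _) (b := y ∈ _)]

theorem rho_nonneg (hη : ∀ i, 0 ≤ η i) (x y : X) : 0 ≤ rho J η x y := by
  unfold rho
  split_ifs
  · refine Real.sInf_nonneg ?_
    rintro c ⟨i, S, -, -, -, rfl⟩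
    exact mul_nonneg (hη i) dist_nonneg
  · exact dist_nonneg

theorem rho_le_of_mem (hη : ∀ i, 0 ≤ η i) {i : ℕ} {S : Set X} (hS : S ∈ J i) {x y : X}
    (hx : x ∈ S) (hy : y ∈ S) : rho J η x y ≤ η i * dist x y := by
  unfold rho
  rw [if_pos ⟨i, S, hS, hx, hy⟩]
  refine csInf_le ⟨0, ?_⟩ ⟨i, S, hS, hx, hy, rfl⟩
  rintro c ⟨i, S, -, -, -, rfl⟩
  exact mul_nonneg (hη i) dist_nonneg

theorem rho_le_dist (hη : ∀ i, 0 < η i ∧ η i ≤ 1) (x y : X) : rho J η x y ≤ dist x y := by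
  by_cases h : ∃ i, ∃ S ∈ J i, x ∈ S ∧ y ∈ S
  · obtain ⟨i, S, hS, hx, hy⟩ := h
    exact (rho_le_of_mem (fun i => (hη i).1.le) hS hx hy).trans
      (mul_le_of_le_one_left dist_nonneg (hη i).2)
  · simp [rho, h]

/-- `Chain J η x y c`: some finite chain from `x` to `y` has `ρ_η`-length `c`. -/
inductive Chain (J : ℕ → Set (Set X)) (η : ℕ → ℝ) : X → X → ℝ → Prop
  | single (x y : X) : Chain J η x y (rho J η x y)
  | cons (x : X) {y z : X} {c : ℝ} (h : Chain J η y z c) : Chain J η x z (rho J η x y + c)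

theorem Chain.append {x y z : X} {c c' : ℝ} (h : Chain J η x y c) (h' : Chain J η y z c') :
    Chain J η x z (c + c') := by
  induction h with
  | single x y => exact .cons x h'
  | cons x h ih => rw [add_assoc]; exact .cons x (ih h')

theorem Chain.symm {x y : X} {c : ℝ} (h : Chain J η x y c) : Chain J η y x c := by
  induction h with
  | single x y => rw [rho_symm]; exact .single y x
  | cons x h ih => rw [add_comm, rho_symm]; exact ih.append (.single _ _)

theorem Chain.nonneg (hη : ∀ i, 0 ≤ η i) {x y : X} {c : ℝ} (h : Chain J η x y c) : 0 ≤ c := by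
  induction h with
  | single x y => exact rho_nonneg hη x y
  | cons x h ih => exact add_nonneg (rho_nonneg hη _ _) ih

theorem chain_iff {x y : X} {c : ℝ} : Chain J η x y c ↔
    ∃ (n : ℕ) (p : ℕ → X), p 0 = x ∧ p (n + 1) = y ∧
      c = ∑ k ∈ Finset.range (n + 1), rho J η (p k) (p (k + 1)) := by
  constructor
  · intro h
    induction h with
    | single x y => exact ⟨0, fun k => if k = 0 then x else y, by simp⟩
    | cons x h ih =>
      obtain ⟨n, p, h0, h1, rfl⟩ := ih
      refine ⟨n + 1, fun k => Nat.casesOn k x p, rfl, h1, ?_⟩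
      rw [Finset.sum_range_succ' _ (n + 1), add_comm]
      simp [h0]
  · rintro ⟨n, p, rfl, rfl, rfl⟩
    induction n generalizing p with
    | zero => simpa using Chain.single (p 0) (p 1)
    | succ n ih =>
      rw [Finset.sum_range_succ', add_comm (∑ k ∈ _, _)]
      exact .cons _ (ih fun k => p (k + 1))

theorem shortcutDist_eq_sInf (x y : X) : shortcutDist J η x y = sInf {c | Chain J η x y c} := by
  simp only [shortcutDist, chain_iff]

theorem Chain.shortcutDist_le (hη : ∀ i, 0 ≤ η i) {x y : X} {c : ℝ} (h : Chain J η x y c) :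
    shortcutDist J η x y ≤ c := by
  rw [shortcutDist_eq_sInf]
  exact csInf_le ⟨0, fun c hc => hc.nonneg hη⟩ h

theorem exists_chain_lt {x y : X} {r : ℝ} (h : shortcutDist J η x y < r) :
    ∃ c < r, Chain J η x y c := by
  rw [shortcutDist_eq_sInf] at h
  obtain ⟨c, hc, hcr⟩ := exists_lt_of_csInf_lt ⟨_, Chain.single x y⟩ h
  exact ⟨c, hcr, hc⟩

theorem shortcutDist_nonneg (hη : ∀ i, 0 ≤ η i) (x y : X) : 0 ≤ shortcutDist J η x y := by
  rw [shortcutDist_eq_sInf]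
  exact Real.sInf_nonneg fun c hc => hc.nonneg hη

theorem shortcutDist_symm (x y : X) : shortcutDist J η x y = shortcutDist J η y x := by
  simp only [shortcutDist_eq_sInf]
  congr 1
  exact Set.ext fun c => ⟨Chain.symm, Chain.symm⟩

theorem shortcutDist_triangle (hη : ∀ i, 0 ≤ η i) (x y z : X) :
    shortcutDist J η x z ≤ shortcutDist J η x y + shortcutDist J η y z := by
  refine le_of_forall_pos_le_add fun e he => ?_
  obtain ⟨c, hc, h⟩ := exists_chain_lt (lt_add_of_pos_right (shortcutDist J η x y) (half_pos he))
  obtain ⟨c', hc', h'⟩ := exists_chain_lt (lt_add_of_pos_right (shortcutDist J η y z) (half_pos he))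
  have := (h.append h').shortcutDist_le hη
  linarith

theorem shortcutDist_le_dist (hη : ∀ i, 0 < η i ∧ η i ≤ 1) (x y : X) :
    shortcutDist J η x y ≤ dist x y :=
  ((Chain.single x y).shortcutDist_le fun i => (hη i).1.le).trans (rho_le_dist hη x y)

theorem shortcutDist_le_of_mem (hη : ∀ i, 0 ≤ η i) {i : ℕ} {S : Set X} (hS : S ∈ J i) {x y : X}
    (hx : x ∈ S) (hy : y ∈ S) : shortcutDist J η x y ≤ η i * dist x y :=
  ((Chain.single x y).shortcutDist_le hη).trans (rho_le_of_mem hη hS hx hy)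

/-- A map that is Lipschitz for `d` and constant on the shortcuts is Lipschitz for `d_η`. -/
theorem IsLipschitz.shortcutDist_of_const {Z : Type*} [PseudoMetricSpace Z] {g : X → Z}
    (hg : IsLipschitz dist g)
    (hJ : ∀ i, ∀ S ∈ J i, ∀ x ∈ S, ∀ y ∈ S, dist (g x) (g y) = 0) (hη : ∀ i, 0 ≤ η i) :
    IsLipschitz (shortcutDist J η) g := by
  obtain ⟨L, hL, hg⟩ := hg
  have hrho : ∀ x y, dist (g x) (g y) ≤ L * rho J η x y := by
    intro x y
    by_cases h : ∃ i, ∃ S ∈ J i, x ∈ S ∧ y ∈ S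
    · obtain ⟨i, S, hS, hx, hy⟩ := h
      rw [hJ i S hS x hx y hy]
      exact mul_nonneg hL (rho_nonneg hη x y)
    · simpa [rho, h] using hg x y
  have hchain : ∀ x y c, Chain J η x y c → dist (g x) (g y) ≤ L * c := by
    intro x y c h
    induction h with
    | single x y => exact hrho x y
    | @cons x y z c h ih =>
      have := dist_triangle (g x) (g y) (g z)
      have := hrho x y
      rw [mul_add]
      linarith
  refine ⟨L, hL, fun x y => ?_⟩
  rcases hL.eq_or_lt with rfl | hL0
  · simpa using hchain x y _ (.single x y)
  refine le_of_forall_pos_le_add fun e he => ?_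
  obtain ⟨c, hc, h⟩ := exists_chain_lt (lt_add_of_pos_right (shortcutDist J η x y) (div_pos he hL0))
  refine (hchain x y c h).trans ((mul_le_mul_of_nonneg_left hc.le hL).trans_eq ?_)
  field_simp

end Chains

/-! ### Reduction of chains to a single shortcut -/

section Reduction

variable {X : Type*} [MetricSpace X]

/-- The conditions on shortcuts used below, with named constants. -/
structure ShortcutBounds (J : ℕ → Set (Set X)) (δ : ℕ → ℝ) (a a₀ b : ℝ) : Prop where
  delta_pos : ∀ i, 0 < δ i
  tendsto : Tendsto δ atTop (𝓝 0)
  a_pos : 0 < a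
  a₀_pos : 0 < a₀
  b_pos : 0 < b
  le_dist : ∀ i, ∀ S ∈ J i, ∀ x ∈ S, ∀ y ∈ S, x ≠ y → a₀ * δ i ≤ dist x y
  dist_le : ∀ i, ∀ S ∈ J i, ∀ x ∈ S, ∀ y ∈ S, dist x y ≤ a * δ i
  separated : ∀ i j, i ≤ j → ∀ S ∈ J i, ∀ S' ∈ J j, S ≠ S' →
      ∀ x ∈ S, ∀ y ∈ S', b * δ j ≤ dist x y
  detour : ∀ i, ∀ S ∈ J i, ∀ x, (∀ s ∈ S, b * δ i ≤ dist s x) → ∀ y,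
      (∀ s ∈ S, b * δ i ≤ dist s y) → ∀ z ∈ S, ∀ w ∈ S, dist x y ≤ dist x z + dist w y
  finite : ∀ i, ∀ S ∈ J i, S.Finite

theorem HasShortcuts.exists_bounds {J : ℕ → Set (Set X)} {δ : ℕ → ℝ} (h : HasShortcuts J δ) :
    ∃ a a₀ b, ShortcutBounds J δ a a₀ b := by
  obtain ⟨hδ, hlim, -, -, a, a₀, b, M, ha, ha₀, hb, -, hdist, hsep, hdet, hfin, -⟩ := h
  have hnot : ∀ i (S : Set X) x, (∀ s ∈ S, b * δ i ≤ dist s x) →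
      x ∉ openNhd dist S (b * δ i) := by
    intro i S x hx
    simp only [openNhd, setDist, mem_ofPred_eq, not_lt]
    exact le_iInf₂ fun s hs => ENNReal.ofReal_le_ofReal (hx s hs)
  refine ⟨a, a₀, b, hδ, hlim, ha, ha₀, hb,
    fun i S hS x hx y hy hxy => (hdist i S hS x hx y hy hxy).1,
    fun i S hS x hx y hy => ?_, hsep, fun i S hS x hx y hy z hz w hw =>
    hdet i S hS x (hnot i S x hx) y (hnot i S y hy) z hz w hw, fun i S hS => (hfin i S hS).1⟩
  by_cases hxy : x = y
  · rw [hxy, dist_self]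
    exact (mul_pos ha (hδ i)).le
  · exact (hdist i S hS x hx y hy hxy).2

/-- A jump between two points of one shortcut. -/
structure Jump (J : ℕ → Set (Set X)) where
  level : ℕ
  set : Set X
  src : X
  tgt : X
  set_mem : set ∈ J level
  src_mem : src ∈ set
  tgt_mem : tgt ∈ set

variable {J : ℕ → Set (Set X)} {δ η : ℕ → ℝ} {a a₀ b : ℝ}

/-- The weight of a jump. -/
def Jump.weight (η : ℕ → ℝ) (j : Jump J) : ℝ := η j.level * dist j.src j.tgt

theorem Jump.weight_nonneg (hη : ∀ i, 0 ≤ η i) (j : Jump J) : 0 ≤ j.weight η :=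
  mul_nonneg (hη _) dist_nonneg

/-- The length of a route that starts at the source of a jump, makes the jumps of a list and
ends at `y`, where the gaps between consecutive jumps are weighted with the factor `C`. -/
def routeLength (η : ℕ → ℝ) (C : ℝ) (y : X) : Jump J → List (Jump J) → ℝ
  | j, [] => j.weight η + dist j.tgt y
  | j, k :: l => j.weight η + C * dist j.tgt k.src + routeLength η C y k l

/-- Two jumps in the same shortcut can be replaced by one. -/
theorem exists_merge (hη : ∀ i, 0 < η i ∧ η i ≤ 1) {C : ℝ} (hC : 1 ≤ C) (j k : Jump J)
    (h : j.set = k.set) : ∃ j' : Jump J, j'.src = j.src ∧ j'.tgt = k.tgt ∧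
      j'.weight η ≤ j.weight η + C * dist j.tgt k.src + k.weight η := by
  have hd : dist j.src k.tgt ≤ dist j.src j.tgt + dist j.tgt k.src + dist k.src k.tgt :=
    dist_triangle4 _ _ _ _
  have h1 : ∀ i, η i * dist j.tgt k.src ≤ C * dist j.tgt k.src := fun i =>
    mul_le_mul_of_nonneg_right ((hη i).2.trans hC) dist_nonneg
  -- One set may be recorded at two levels; the merged jump keeps the level with the smaller `η`.
  rcases le_total (η j.level) (η k.level) with hle | hle
  · refine ⟨⟨j.level, j.set, j.src, k.tgt, j.set_mem, j.src_mem, h ▸ k.tgt_mem⟩, rfl, rfl, ?_⟩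
    have := mul_le_mul_of_nonneg_left hd (hη j.level).1.le
    have := mul_le_mul_of_nonneg_right hle (dist_nonneg (x := k.src) (y := k.tgt))
    have := h1 j.level
    simp only [Jump.weight]
    linarith
  · refine ⟨⟨k.level, k.set, j.src, k.tgt, k.set_mem, h ▸ j.src_mem, k.tgt_mem⟩, rfl, rfl, ?_⟩
    have := mul_le_mul_of_nonneg_left hd (hη k.level).1.le
    have := mul_le_mul_of_nonneg_right hle (dist_nonneg (x := j.src) (y := j.tgt))
    have := h1 k.level
    simp only [Jump.weight]
    linarith

theorem routeLength_merge_le {C : ℝ} {y : X} {j k j' : Jump J} {l : List (Jump J)}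
    (ht : j'.tgt = k.tgt)
    (hw : j'.weight η ≤ j.weight η + C * dist j.tgt k.src + k.weight η) :
    routeLength η C y j' l ≤ routeLength η C y j (k :: l) := by
  cases l with
  | nil => simp only [routeLength, ht]; linarith
  | cons q r => simp only [routeLength, ht]; linarith

/-- The gap to a jump of smaller level controls the length of a jump. -/
theorem dist_add_gap_le (hJ : ShortcutBounds J δ a a₀ b) {C : ℝ} (hC : 1 + a / b ≤ C)
    {j k : Jump J} (hlev : j.level ≤ k.level) (hjk : j.set ≠ k.set) {x y : X} (hx : x ∈ j.set)
    (hy : y ∈ k.set) : dist k.src k.tgt + dist x y ≤ C * dist x y := by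
  have h1 := hJ.dist_le _ _ k.set_mem _ k.src_mem _ k.tgt_mem
  have h2 := hJ.separated _ _ hlev _ j.set_mem _ k.set_mem hjk _ hx _ hy
  have h3 : a * δ k.level ≤ a / b * dist x y := by
    have := mul_le_mul_of_nonneg_left h2 (div_pos hJ.a_pos hJ.b_pos).le
    have hb := hJ.b_pos.ne'
    calc a * δ k.level = a / b * (b * δ k.level) := by field_simp
      _ ≤ _ := this
  have := mul_le_mul_of_nonneg_right hC (dist_nonneg (x := x) (y := y))
  linarith

/-- If the second jump of a route has a larger level than the first one, then one of the jumps
after the first can be saved. -/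
theorem exists_shorter_route (hJ : ShortcutBounds J δ a a₀ b) (hη : ∀ i, 0 < η i ∧ η i ≤ 1)
    {C : ℝ} (hC : 1 + a / b ≤ C) (y : X) (l : List (Jump J)) : ∀ j k : Jump J, j.set ≠ k.set →
      j.level < k.level → ∃ l' : List (Jump J), l'.length ≤ l.length ∧
        routeLength η C y j l' ≤ routeLength η C y j (k :: l) := by
  have hC1 : 1 ≤ C := by linarith [div_pos hJ.a_pos hJ.b_pos]
  have hC0 : 0 ≤ C := zero_le_one.trans hC1
  -- Follow the levels while they increase. At the end of the route the last jump is dropped: its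
  -- gap loses the factor `C` on becoming a terminal gap, and this pays for the length of the jump.
  -- If a jump has level at least that of its successor, it is removed by the detour inequality,
  -- which costs no constant.
  induction l with
  | nil =>
    intro j k hjk hlev
    refine ⟨[], le_rfl, ?_⟩
    have := dist_add_gap_le hJ hC hlev.le hjk j.tgt_mem k.src_mem
    have := dist_triangle4 j.tgt k.src k.tgt y
    have := k.weight_nonneg fun i => (hη i).1.le
    simp only [routeLength]
    linarith
  | cons q r ih =>
    intro j k hjk hlev
    by_cases hkq : k.set = q.set
    · obtain ⟨k', hs, ht, hw⟩ := exists_merge hη hC1 k q hkq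
      refine ⟨k' :: r, le_rfl, ?_⟩
      have := routeLength_merge_le (y := y) (l := r) ht hw
      simp only [routeLength] at this ⊢
      rw [hs]
      linarith
    · rcases lt_or_ge k.level q.level with hlt | hge
      · obtain ⟨l', hl', hle⟩ := ih k q hkq hlt
        refine ⟨k :: l', by simpa using hl', ?_⟩
        simp only [routeLength] at hle ⊢
        linarith
      · refine ⟨q :: r, le_rfl, ?_⟩
        have hd := hJ.detour _ _ k.set_mem j.tgt (fun s hs => by
          rw [dist_comm]
          exact hJ.separated _ _ hlev.le _ j.set_mem _ k.set_mem hjk _ j.tgt_mem _ hs)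
          q.src (fun s hs => by
          rw [dist_comm]
          exact hJ.separated _ _ hge _ q.set_mem _ k.set_mem (Ne.symm hkq) _ q.src_mem _ hs)
          _ k.src_mem _ k.tgt_mem
        have := mul_le_mul_of_nonneg_left hd hC0
        have := k.weight_nonneg fun i => (hη i).1.le
        simp only [routeLength]
        linarith

/-- Every route is at least as long as one with a single jump. -/
theorem exists_single_jump (hJ : ShortcutBounds J δ a a₀ b) (hη : ∀ i, 0 < η i ∧ η i ≤ 1)
    {C : ℝ} (hC : 1 + a / b ≤ C) (x y : X) (n : ℕ) : ∀ (j : Jump J) (l : List (Jump J)),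
      l.length = n → ∃ k : Jump J, dist x k.src + k.weight η + dist k.tgt y ≤
        dist x j.src + routeLength η C y j l := by
  have hC1 : 1 ≤ C := by linarith [div_pos hJ.a_pos hJ.b_pos]
  induction n using Nat.strong_induction_on with
  | _ n ih =>
    intro j l hl
    cases l with
    | nil => exact ⟨j, by simp only [routeLength]; linarith⟩
    | cons k l =>
      have hl' : l.length < n := by simp only [List.length_cons] at hl; omega
      by_cases hjk : j.set = k.set
      · obtain ⟨j', hs, ht, hw⟩ := exists_merge hη hC1 j k hjk
        obtain ⟨q, hq⟩ := ih _ hl' j' l rfl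
        refine ⟨q, hq.trans ?_⟩
        rw [hs]
        have := routeLength_merge_le (y := y) (l := l) ht hw
        linarith
      · rcases lt_or_ge j.level k.level with hlt | hge
        · obtain ⟨l', hll, hle⟩ := exists_shorter_route hJ hη hC y l j k hjk hlt
          obtain ⟨q, hq⟩ := ih _ (hll.trans_lt hl') j l' rfl
          exact ⟨q, by linarith⟩
        -- The first jump is dropped. The gap after it, weighted by `C`, becomes an initial gap of
        -- weight one, so the constant does not compound with the number of jumps.
        · obtain ⟨q, hq⟩ := ih _ hl' k l rfl
          refine ⟨q, hq.trans ?_⟩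
          have h1 := dist_add_gap_le hJ hC hge (Ne.symm hjk) k.src_mem j.tgt_mem
          rw [dist_comm k.src j.tgt] at h1
          have := dist_triangle4 x j.src j.tgt k.src
          have := j.weight_nonneg fun i => (hη i).1.le
          simp only [routeLength]
          linarith

/-- If `x`, `y` lie in a common shortcut, then `ρ_η(x, y)` is the weight of a jump. -/
theorem rho_eq_dist_or_weight (hJ : ShortcutBounds J δ a a₀ b) (x y : X) :
    rho J η x y = dist x y ∨ ∃ j : Jump J, j.src = x ∧ j.tgt = y ∧ rho J η x y = j.weight η := by
  by_cases h : ∃ i, ∃ S ∈ J i, x ∈ S ∧ y ∈ S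
  swap
  · exact Or.inl (by simp [rho, h])
  right
  have hmem : rho J η x y ∈ {c | ∃ i, ∃ S ∈ J i, x ∈ S ∧ y ∈ S ∧ c = η i * dist x y} := by
    unfold rho
    rw [if_pos h]
    obtain ⟨i₀, S₀, hS₀, hx₀, hy₀⟩ := h
    -- The infimum is attained: since `δ` tends to zero, two distinct points share shortcuts at only
    -- finitely many levels.
    refine Set.Nonempty.csInf_mem ⟨_, i₀, S₀, hS₀, hx₀, hy₀, rfl⟩ ?_
    by_cases hxy : x = y
    · refine (finite_singleton (0 : ℝ)).subset ?_
      rintro c ⟨i, S, -, -, -, rfl⟩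
      simp [hxy]
    have hev : ∀ᶠ i in atTop, a * δ i < dist x y := by
      have := hJ.tendsto.const_mul a
      rw [mul_zero] at this
      exact this.eventually_lt_const (dist_pos.2 hxy)
    obtain ⟨N, hN⟩ := eventually_atTop.1 hev
    refine ((finite_Iio N).image fun i => η i * dist x y).subset ?_
    rintro c ⟨i, S, hS, hx, hy, rfl⟩
    refine ⟨i, ?_, rfl⟩
    by_contra hi
    exact absurd (hJ.dist_le i S hS x hx y hy) (not_le.2 (hN i (not_lt.1 hi)))
  obtain ⟨i, S, hS, hx, hy, hc⟩ := hmem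
  exact ⟨⟨i, S, x, y, hS, hx, hy⟩, rfl, rfl, hc⟩

/-- Links that are not jumps are absorbed into the neighbouring gap by the triangle inequality. The
first alternative is the case without jumps; multiplying the whole length by `C` pays for the
weights on the gaps. -/
theorem Chain.exists_route (hJ : ShortcutBounds J δ a a₀ b) {C : ℝ} (hC : 1 ≤ C)
    (hη : ∀ i, 0 ≤ η i) {x y : X} {c : ℝ} (h : Chain J η x y c) :
    dist x y ≤ c ∨ ∃ (j : Jump J) (l : List (Jump J)),
      C * dist x j.src + routeLength η C y j l ≤ C * c := by
  have hC0 : 0 ≤ C := zero_le_one.trans hC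
  induction h with
  | single x y =>
    rcases rho_eq_dist_or_weight (η := η) hJ x y with h | ⟨j, rfl, rfl, h⟩
    · exact Or.inl h.ge
    · refine Or.inr ⟨j, [], ?_⟩
      have := le_mul_of_one_le_left (j.weight_nonneg hη) hC
      simp only [routeLength, dist_self, h]
      linarith
  | @cons x y z c h ih =>
    rcases rho_eq_dist_or_weight (η := η) hJ x y with h | ⟨k, rfl, rfl, h⟩
    · rw [h]
      rcases ih with ih | ⟨j, l, ih⟩
      · exact Or.inl (by linarith [dist_triangle x y z])
      · refine Or.inr ⟨j, l, ?_⟩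
        have := mul_le_mul_of_nonneg_left (dist_triangle x y j.src) hC0
        linarith
    · rw [h]
      have hk := le_mul_of_one_le_left (k.weight_nonneg hη) hC
      rcases ih with ih | ⟨j, l, ih⟩
      · refine Or.inr ⟨k, [], ?_⟩
        have := le_mul_of_one_le_left (dist_nonneg (x := k.tgt) (y := z)) hC
        have := mul_le_mul_of_nonneg_left ih hC0
        simp only [routeLength, dist_self]
        linarith
      · refine Or.inr ⟨k, j :: l, ?_⟩
        simp only [routeLength, dist_self]
        linarith

/-- Up to a constant factor, `d_η` is realized by chains with at most one shortcut. -/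
theorem exists_dist_le_or_jump (hJ : ShortcutBounds J δ a a₀ b) (hη : ∀ i, 0 < η i ∧ η i ≤ 1) :
    ∃ C : ℝ, 1 ≤ C ∧ ∀ x y r, shortcutDist J η x y < r → dist x y ≤ C * r ∨
      ∃ i, ∃ S ∈ J i, ∃ z ∈ S, ∃ w ∈ S, dist x z ≤ C * r ∧ dist w y ≤ C * r ∧
        η i * δ i ≤ C * r := by
  have hq := div_pos hJ.a_pos hJ.b_pos
  set C := 1 + a / b with hC
  have hC1 : 1 ≤ C := by linarith
  have ha₀ := hJ.a₀_pos
  have hCa : C ≤ C * (1 + 1 / a₀) :=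
    le_mul_of_one_le_right (by linarith) (by linarith [one_div_pos.2 ha₀])
  refine ⟨C * (1 + 1 / a₀), hC1.trans hCa, fun x y r hr => ?_⟩
  have hr0 : 0 < r := (shortcutDist_nonneg (fun i => (hη i).1.le) x y).trans_lt hr
  have hCr : C * r ≤ C * (1 + 1 / a₀) * r := mul_le_mul_of_nonneg_right hCa hr0.le
  obtain ⟨c, hcr, hc⟩ := exists_chain_lt hr
  rcases hc.exists_route hJ hC1 (fun i => (hη i).1.le) with h | ⟨j, l, h⟩
  · left
    have := le_mul_of_one_le_left hr0.le hC1
    linarith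
  obtain ⟨k, hk⟩ := exists_single_jump hJ hη hC.ge x y _ j l rfl
  have h1 := le_mul_of_one_le_left (dist_nonneg (x := x) (y := j.src)) hC1
  have h2 : C * c ≤ C * r := mul_le_mul_of_nonneg_left hcr.le (by linarith)
  have h3 := k.weight_nonneg fun i => (hη i).1.le
  have h4 : dist x k.src + k.weight η + dist k.tgt y ≤ C * r := by linarith
  have h5 := dist_nonneg (x := x) (y := k.src)
  have h6 := dist_nonneg (x := k.tgt) (y := y)
  by_cases hne : k.src = k.tgt
  · left
    have := dist_triangle x k.src y
    have h7 : dist k.src y = dist k.tgt y := by rw [hne]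
    linarith
  right
  refine ⟨k.level, k.set, k.set_mem, k.src, k.src_mem, k.tgt, k.tgt_mem, by linarith, by linarith, ?_⟩
  have h7 := hJ.le_dist _ _ k.set_mem _ k.src_mem _ k.tgt_mem hne
  have h8 : η k.level * (a₀ * δ k.level) ≤ C * r := by
    have := mul_le_mul_of_nonneg_left h7 (hη k.level).1.le
    simp only [Jump.weight] at h4
    linarith
  have h9 : η k.level * δ k.level ≤ C * r * (1 / a₀) := by
    rw [mul_one_div, le_div_iff₀ ha₀]
    linarith
  have : 0 ≤ C * r := mul_nonneg (by linarith) hr0.le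
  nlinarith

/-- The position of a third point `u` that is `d_η`-close to `y` relative to a jump that
realizes the distance between `x` and `y`. -/
theorem exists_dist_le_or_jump_near (hJ : ShortcutBounds J δ a a₀ b)
    (hη : ∀ i, 0 < η i ∧ η i ≤ 1) :
    ∃ R : ℝ, 1 ≤ R ∧ ∀ x y u r s, s ≤ r → shortcutDist J η x y < r → shortcutDist J η y u < s →
      dist x y ≤ R * r ∨ ∃ i, ∃ S ∈ J i, ∃ z ∈ S, ∃ w ∈ S, dist x z ≤ R * r ∧
        η i * δ i ≤ R * r ∧ (dist u w ≤ R * r ∨ dist w y ≤ R * s) := by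
  obtain ⟨C, hC, hkey⟩ := exists_dist_le_or_jump hJ hη
  have hb := hJ.b_pos
  have ha := hJ.a_pos
  set K := a / b with hK
  have hK0 : 0 < K := div_pos ha hb
  have hCK : 0 ≤ C * K := mul_nonneg (by linarith) hK0.le
  have hsmall : ∀ t q, b * t ≤ 2 * C * q → a * t ≤ 2 * (C * K) * q := by
    intro t q h
    have := mul_le_mul_of_nonneg_left h hK0.le
    have e : K * (b * t) = a * t := by rw [hK]; field_simp
    rw [e] at this
    linarith
  refine ⟨4 * C + 2 * (C * K), by linarith, fun x y u r s hsr hxy hyu => ?_⟩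
  have hs0 : 0 < s := (shortcutDist_nonneg (fun i => (hη i).1.le) y u).trans_lt hyu
  have hr0 : 0 < r := hs0.trans_le hsr
  have hCs : C * s ≤ C * r := mul_le_mul_of_nonneg_left hsr (by linarith)
  have hCr : 0 ≤ C * r := mul_nonneg (by linarith) hr0.le
  have hCs0 : 0 ≤ C * s := mul_nonneg (by linarith) hs0.le
  have hCKr : 0 ≤ C * K * r := mul_nonneg hCK hr0.le
  have hCKs : 0 ≤ C * K * s := mul_nonneg hCK hs0.le
  rcases hkey x y r hxy with h | ⟨i, S, hS, z, hz, w, hw, hxz, hwy, hηδ⟩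
  · left; linarith
  rcases hkey y u s hyu with h | ⟨j, S', hS', z', hz', w', hw', hyz, hwu, -⟩
  · right
    refine ⟨i, S, hS, z, hz, w, hw, by linarith, by linarith, Or.inl ?_⟩
    have := dist_triangle_right u w y
    rw [dist_comm u y] at this
    linarith
  by_cases hSS : S = S'
  -- Both jumps use the same shortcut, so the landing point is changed to `z'`, which is close to
  -- `y` at the finer scale `s`.
  · subst hSS
    right
    refine ⟨i, S, hS, z, hz, z', hz', by linarith, by linarith, Or.inr ?_⟩
    rw [dist_comm]
    linarith
  have hwz : dist w z' ≤ 2 * C * r := by linarith [dist_triangle w y z']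
  -- The shortcuts are distinct and come within `2 * C * r` of each other, so separation bounds the
  -- diameter of the one of larger level by a multiple of `r`; that jump can then be replaced by a
  -- direct step.
  rcases le_total i j with hij | hij
  · right
    refine ⟨i, S, hS, z, hz, w, hw, by linarith, by linarith, Or.inl ?_⟩
    have h1 := hsmall (δ j) r ((hJ.separated i j hij S hS S' hS' hSS w hw z' hz').trans hwz)
    have h2 := hJ.dist_le j S' hS' z' hz' w' hw'
    have := dist_triangle4 w z' w' u
    rw [dist_comm]
    linarith
  · left
    have h0 := hJ.separated j i hij S' hS' S hS (Ne.symm hSS) z' hz' w hw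
    rw [dist_comm] at h0
    have h1 := hsmall (δ i) r (h0.trans hwz)
    have h2 := hJ.dist_le i S hS z hz w hw
    have := dist_triangle4 x z w y
    linarith

end Reduction

/-! ### Differentials and their separability -/

section Differentials

variable {X : Type*} {Y : Type*} [NormedAddCommGroup Y] [NormedSpace ℝ Y]

theorem IsLipschitz.sub_linear_comp {D : X → X → ℝ} {n : ℕ} {φ : X → EuclideanSpace ℝ (Fin n)} {f : X → Y} (hf : IsLipschitz D f) (hφ : IsLipschitz D φ)
    (T : EuclideanSpace ℝ (Fin n) →ₗ[ℝ] Y) : IsLipschitz D fun y => f y - T (φ y) := by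
  obtain ⟨L, hL, hf⟩ := hf
  obtain ⟨L', hL', hφ⟩ := hφ
  set T' := LinearMap.toContinuousLinearMap T
  refine ⟨L + ‖T'‖ * L', by positivity, fun x y => ?_⟩
  have h1 : dist (T (φ x)) (T (φ y)) ≤ ‖T'‖ * (L' * D x y) := by
    rw [dist_eq_norm, ← map_sub]
    refine (T'.le_opNorm _).trans (mul_le_mul_of_nonneg_left ?_ (norm_nonneg _))
    rw [← dist_eq_norm]
    exact hφ x y
  have h2 := dist_sub_sub_le (f x) (T (φ x)) (f y) (T (φ y))
  linarith [hf x y]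

/-- The differential takes values in every closed subspace that contains the image of `f`. -/
theorem IsCheegerDifferential.apply_mem {D : X → X → ℝ} {n : ℕ}
    {φ : X → EuclideanSpace ℝ (Fin n)} {f : X → Y} {x : X} {T : EuclideanSpace ℝ (Fin n) →ₗ[ℝ] Y}
    (hT : IsCheegerDifferential D φ f x T) {V : Submodule ℝ Y} (hV : IsClosed (V : Set Y))
    (hf : ∀ y, f y ∈ V) (v : EuclideanSpace ℝ (Fin n)) : T v ∈ V := by
  by_contra hv
  obtain ⟨ℓ, c, hℓ, hc⟩ := geometric_hahn_banach_closed_point V.convex hV hv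
  have hℓV : ∀ y ∈ V, ℓ y = 0 := by
    intro y hy
    by_contra hne
    have := hℓ _ (V.smul_mem (c / ℓ y) hy)
    rw [map_smul, smul_eq_mul, div_mul_cancel₀ _ hne] at this
    exact lt_irrefl _ this
  have hc0 : 0 < c := by simpa using hℓ 0 V.zero_mem
  have hTv : ℓ (T v) ≠ 0 := (hc0.trans hc).ne'
  have hTv0 : T v ≠ 0 := fun h => hTv (by simp [h])
  -- A competing differential: `ℓ` vanishes on the values of `f`, so passing from `T` to `T'`
  -- changes the error `e` only to `e + ℓ e • T v`, which is still of lower order. Uniqueness then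
  -- contradicts `ℓ (T v) ≠ 0`.
  set T' : EuclideanSpace ℝ (Fin n) →ₗ[ℝ] Y :=
    T + ((ℓ : Y →ₗ[ℝ] ℝ) ∘ₗ T).smulRight (T v) with hT'
  have heq : T' = T := by
    refine hT.2 T' (lipAtWithin_eq_zero_iff.2 fun ε hε => ?_)
    have hM : 0 < 1 + ‖ℓ‖ * ‖T v‖ := by positivity
    obtain ⟨r, hr, h⟩ := lipAtWithin_eq_zero_iff.1 hT.1 (ε / (1 + ‖ℓ‖ * ‖T v‖)) (by positivity)
    refine ⟨r, hr, fun y hy h0 h1 => ?_⟩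
    have hb := h y hy h0 h1
    rw [dist_eq_norm] at hb ⊢
    set e := f x - T (φ x) - (f y - T (φ y)) with he
    have hid : f x - T' (φ x) - (f y - T' (φ y)) = e + ℓ e • T v := by
      have : ℓ e = ℓ (T (φ y)) - ℓ (T (φ x)) := by
        simp only [he, map_sub, hℓV _ (hf _)]
        ring
      rw [this, he, hT']
      simp only [LinearMap.add_apply, LinearMap.smulRight_apply, LinearMap.comp_apply,
        ContinuousLinearMap.coe_coe, sub_smul]
      abel
    rw [hid]
    calc ‖e + ℓ e • T v‖ ≤ ‖e‖ + ‖ℓ e • T v‖ := norm_add_le _ _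
      _ ≤ ‖e‖ + ‖ℓ‖ * ‖e‖ * ‖T v‖ := by
        rw [norm_smul]; gcongr; exact ℓ.le_opNorm e
      _ = (1 + ‖ℓ‖ * ‖T v‖) * ‖e‖ := by ring
      _ ≤ (1 + ‖ℓ‖ * ‖T v‖) * (ε / (1 + ‖ℓ‖ * ‖T v‖) * D x y) := by gcongr
      _ = ε * D x y := by field_simp
  have := LinearMap.congr_fun heq v
  simp only [hT', LinearMap.add_apply, LinearMap.smulRight_apply, LinearMap.comp_apply,
    ContinuousLinearMap.coe_coe, add_eq_left, smul_eq_zero] at this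
  exact this.elim hTv hTv0

/-- The differentials of a continuous map on a separable space can be approximated by members of
a countable family. -/
theorem exists_countable_approx_differential [TopologicalSpace X]
    [TopologicalSpace.SeparableSpace X] {f : X → Y} (hf : Continuous f) (n : ℕ) :
    ∃ 𝒯 : Set (EuclideanSpace ℝ (Fin n) →ₗ[ℝ] Y), 𝒯.Countable ∧
      ∀ (D : X → X → ℝ) (φ : X → EuclideanSpace ℝ (Fin n)) (x : X) (T),
        IsCheegerDifferential D φ f x T → ∀ ε > 0, ∃ T₀ ∈ 𝒯, ∀ v, ‖T v - T₀ v‖ ≤ ε * ‖v‖ := by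
  -- `Y` need not be separable, but all differentials take values in this separable subspace.
  set V : Submodule ℝ Y := (Submodule.span ℝ (range f)).topologicalClosure with hV
  have hVc : IsClosed (V : Set Y) := Submodule.isClosed_topologicalClosure _
  have hfV : ∀ y, f y ∈ V := fun y =>
    Submodule.le_topologicalClosure _ (Submodule.subset_span (mem_range_self y))
  have hsep : TopologicalSpace.IsSeparable (V : Set Y) := by
    rw [hV, Submodule.topologicalClosure_coe]
    exact (TopologicalSpace.IsSeparable.span (TopologicalSpace.isSeparable_range hf)).closure
  have : TopologicalSpace.SeparableSpace V := hsep.separableSpace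
  have : SecondCountableTopology V := UniformSpace.secondCountable_of_separable V
  obtain ⟨s, hs, hsd⟩ :=
    TopologicalSpace.exists_countable_dense (EuclideanSpace ℝ (Fin n) →L[ℝ] V)
  refine ⟨(fun A : EuclideanSpace ℝ (Fin n) →L[ℝ] V =>
    V.subtype ∘ₗ (A : EuclideanSpace ℝ (Fin n) →ₗ[ℝ] V)) '' s, hs.image _, ?_⟩
  intro D φ x T hT ε hε
  set A : EuclideanSpace ℝ (Fin n) →L[ℝ] V :=
    LinearMap.toContinuousLinearMap (T.codRestrict V (hT.apply_mem hVc hfV)) with hA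
  obtain ⟨B, hB, hAB⟩ := hsd.exists_dist_lt A hε
  refine ⟨_, mem_image_of_mem _ hB, fun v => ?_⟩
  have h := (A - B).le_opNorm v
  have hAB' : ‖A - B‖ < ε := (dist_eq_norm A B).symm.trans_lt hAB
  exact h.trans (mul_le_mul_of_nonneg_right hAB'.le (norm_nonneg v))

end Differentials

/-! ### Behaviour at points outside and inside `Bad(f)` -/

section Bad

variable {X : Type*} [MetricSpace X] {Y : Type*} [NormedAddCommGroup Y]
  {J : ℕ → Set (Set X)} {δ η : ℕ → ℝ} {a a₀ b : ℝ}

/-- A smaller `ε` both lowers the oscillation threshold and widens the neighbourhoods. -/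
theorem badEps_anti (hδ : ∀ i, 0 < δ i) (hη : ∀ i, 0 < η i) (f : X → Y) {ε ε' : ℝ} (hε' : 0 < ε')
    (h : ε' ≤ ε) : badEps J δ η f ε ⊆ badEps J δ η f ε' := by
  intro x hx
  rw [badEps, mem_limsup_iff_frequently_mem] at hx ⊢
  refine hx.mono fun i hi => ?_
  have hpos := mul_pos (hη i) (hδ i)
  refine (?_ : setDist _ _ x ≤ _).trans (le_trans hi (ENNReal.ofReal_le_ofReal ?_))
  · refine biInf_mono fun y hy => ?_
    obtain ⟨S, hS, hyS⟩ := hy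
    refine ⟨S, ⟨hS.1, le_trans ?_ hS.2⟩, hyS⟩
    rw [mul_assoc, mul_assoc]
    exact mul_le_mul_of_nonneg_right h hpos.le
  · exact div_le_div_of_nonneg_left hpos.le hε' h

/-- The set of points at which `g` has Lipschitz constant at most `ε` at scales below `m`. -/
def slowSet (g : X → Y) (ε m : ℝ) : Set X :=
  {u | ∀ v, dist u v < m → dist (g u) (g v) ≤ ε * dist u v}

theorem exists_pos_forall_lt_le {t : ℕ → ℝ} (ht : ∀ i, 0 < t i) (N : ℕ) :
    ∃ c : ℝ, 0 < c ∧ ∀ i < N, c ≤ t i := by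
  induction N with
  | zero => exact ⟨1, one_pos, by simp⟩
  | succ N ih =>
    obtain ⟨c, hc, h⟩ := ih
    refine ⟨min c (t N), lt_min hc (ht N), fun i hi => ?_⟩
    rcases Nat.lt_succ_iff_lt_or_eq.1 hi with hi | rfl
    · exact (min_le_left _ _).trans (h i hi)
    · exact min_le_right _ _

/-- Near a point outside `Bad_ε(f)`, the oscillation of `f` on a shortcut is small compared with
its size and the distance to the shortcut. -/
theorem exists_osc_le_of_notMem_badEps (hJ : ShortcutBounds J δ a a₀ b)
    (hη : ∀ i, 0 < η i ∧ η i ≤ 1) {f : X → Y} {L : ℝ} (hL : 0 ≤ L)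
    (hf : ∀ x y, dist (f x) (f y) ≤ L * shortcutDist J η x y) {ε : ℝ} (hε : 0 < ε) {x : X}
    (hx : x ∉ badEps J δ η f ε) :
    ∃ c : ℝ, 0 < c ∧ ∀ t < c, ∀ i, ∀ S ∈ J i, ∀ z ∈ S, ∀ w ∈ S, dist x z ≤ t → η i * δ i ≤ t →
      dist (f z) (f w) ≤ (1 + L * a) * ε * t := by
  rw [badEps, mem_limsup_iff_frequently_mem, not_frequently] at hx
  obtain ⟨N, hN⟩ := eventually_atTop.1 hx
  -- Below this scale `η i * δ i ≤ t` rules out the finitely many levels `i < N`.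
  obtain ⟨c, hc, hcN⟩ := exists_pos_forall_lt_le (fun i => mul_pos (hη i).1 (hJ.delta_pos i)) N
  refine ⟨c, hc, fun t htc i S hS z hz w hw hxz hηδ => ?_⟩
  have hpos := mul_pos (hη i).1 (hJ.delta_pos i)
  have ht : 0 < t := hpos.trans_le hηδ
  have hLa : 0 ≤ L * a := mul_nonneg hL hJ.a_pos.le
  have hi : N ≤ i := by
    by_contra hi
    linarith [hcN i (not_le.1 hi)]
  -- A large shortcut must be so far from `x` that `η i * δ i ≤ ε * dist x z`; the Lipschitz bound
  -- for `f` then suffices.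
  by_cases hlarge : S ∈ largeShortcuts J δ η f ε i
  · have hnot := hN i hi
    have hfar : η i * δ i / ε ≤ dist x z := by
      by_contra! hlt
      refine hnot (show setDist _ _ x ≤ _ from (iInf₂_le z (mem_sUnion_of_mem hz hlarge)).trans
        (ENNReal.ofReal_le_ofReal ?_))
      exact (shortcutDist_le_dist hη z x).trans (by rw [dist_comm]; exact hlt.le)
    rw [div_le_iff₀ hε] at hfar
    calc dist (f z) (f w) ≤ L * shortcutDist J η z w := hf z w
      _ ≤ L * (η i * dist z w) := mul_le_mul_of_nonneg_left
          (shortcutDist_le_of_mem (fun i => (hη i).1.le) hS hz hw) hL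
      _ ≤ L * (η i * (a * δ i)) := mul_le_mul_of_nonneg_left
          (mul_le_mul_of_nonneg_left (hJ.dist_le i S hS z hz w hw) (hη i).1.le) hL
      _ = L * a * (η i * δ i) := by ring
      _ ≤ L * a * (dist x z * ε) := mul_le_mul_of_nonneg_left hfar hLa
      _ ≤ L * a * (t * ε) := mul_le_mul_of_nonneg_left (mul_le_mul_of_nonneg_right hxz hε.le) hLa
      _ ≤ (1 + L * a) * ε * t := by linarith [mul_pos hε ht]
  · have hsmall : Metric.diam (f '' S) < ε * η i * δ i := by
      by_contra hge
      exact hlarge ⟨hS, not_lt.1 hge⟩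
    have h1 := Metric.dist_le_diam_of_mem ((hJ.finite i S hS).image f).isBounded
      (mem_image_of_mem f hz) (mem_image_of_mem f hw)
    have h2 := mul_le_mul_of_nonneg_left hηδ hε.le
    have h3 := mul_nonneg hLa (mul_pos hε ht).le
    linarith

/-- Slowness for `d` at `x` and at nearby points upgrades to slowness for `d_η`. `K` depends only on
`f` and the shortcuts, not on `g`, `ε` or `m`: it is fixed before a linear map is chosen, and the
Lipschitz constant of `g` is absorbed into the density parameter `e`. -/
theorem exists_lipschitz_bound_of_notMem_bad (hJ : ShortcutBounds J δ a a₀ b)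
    (hη : ∀ i, 0 < η i ∧ η i ≤ 1) {f : X → Y} (hf : IsLipschitz (shortcutDist J η) f) :
    ∃ K : ℝ, 0 < K ∧ ∀ g : X → Y, IsLipschitz (shortcutDist J η) g →
      (∀ i, ∀ S ∈ J i, ∀ z ∈ S, ∀ w ∈ S, dist (g z) (g w) = dist (f z) (f w)) →
      ∀ ε m : ℝ, 0 < ε → 0 < m → ∀ x ∉ bad J δ η f, x ∈ slowSet g ε m →
      ¬ IsPorousAt (shortcutDist J η) (slowSet g ε m) x →
      ∃ r : ℝ, 0 < r ∧ ∀ y, 0 < shortcutDist J η x y → shortcutDist J η x y < r →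
        dist (g x) (g y) ≤ K * ε * shortcutDist J η x y := by
  obtain ⟨L, hL, hf⟩ := hf
  obtain ⟨R, hR, hnear⟩ := exists_dist_le_or_jump_near hJ hη
  have hη0 : ∀ i, 0 ≤ η i := fun i => (hη i).1.le
  have hLa : 0 ≤ L * a := mul_nonneg hL hJ.a_pos.le
  refine ⟨2 * R * (3 + L * a) + 1, by positivity, ?_⟩
  rintro g ⟨Lg, hLg, hg⟩ hgf ε m hε hm x hbad hxG hpor
  have hxε : x ∉ badEps J δ η f ε := fun h => hbad (mem_iUnion₂.2 ⟨ε, hε, h⟩)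
  obtain ⟨c, hc, hosc⟩ := exists_osc_le_of_notMem_badEps hJ hη hL hf hε hxε
  obtain ⟨e, he, he1, heL⟩ : ∃ e : ℝ, 0 < e ∧ e ≤ 1 ∧ Lg * e ≤ ε := by
    refine ⟨min 1 (ε / (Lg + 1)), lt_min one_pos (by positivity), min_le_left _ _, ?_⟩
    calc Lg * min 1 (ε / (Lg + 1)) ≤ (Lg + 1) * (ε / (Lg + 1)) := by
          gcongr
          · linarith
          · exact min_le_right _ _
      _ = ε := by field_simp
  obtain ⟨r₀, hr₀, hdense⟩ := exists_mem_of_not_isPorousAt (shortcutDist_nonneg hη0) hpor he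
  have hR0 : 0 < R := by linarith
  refine ⟨min r₀ (min (m / (2 * R)) (c / (2 * R))),
    lt_min hr₀ (lt_min (by positivity) (by positivity)), fun y hy0 hy => ?_⟩
  set t := shortcutDist J η x y with ht
  obtain ⟨h1, h2, h3⟩ : t < r₀ ∧ t < m / (2 * R) ∧ t < c / (2 * R) := by
    simpa [lt_min_iff] using hy
  rw [lt_div_iff₀ (by positivity)] at h2 h3
  have htm : R * (2 * t) < m := by linarith
  have htc : R * (2 * t) < c := by linarith
  obtain ⟨u, huG, hu⟩ := hdense y h1
  have het : 0 < e * t := mul_pos he hy0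
  have hεt : 0 < ε * t := mul_pos hε hy0
  have hRεt : ε * t ≤ R * (ε * t) := le_mul_of_one_le_left hεt.le hR
  have hLaεt : 0 ≤ L * a * (R * (ε * t)) := mul_nonneg hLa (hεt.le.trans hRεt)
  have hslow : ∀ p ∈ slowSet g ε m, ∀ q, dist p q ≤ R * (2 * t) →
      dist (g p) (g q) ≤ 2 * R * (ε * t) := by
    intro p hp q hpq
    have := mul_le_mul_of_nonneg_left hpq hε.le
    have := hp q (hpq.trans_lt htm)
    linarith
  -- The factors `2` only make the distance bounds strict.
  rcases hnear x y u (2 * t) (2 * (e * t))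
    (by linarith [mul_le_mul_of_nonneg_right he1 hy0.le]) (by linarith) (by linarith) with
    h | ⟨i, S, hS, z, hz, w, hw, hxz, hηδ, hw'⟩
  · linarith [hslow x hxG y h]
  have hxz' := hslow x hxG z hxz
  have hzw := hosc _ htc i S hS z hz w hw hxz hηδ
  rw [← hgf i S hS z hz w hw] at hzw
  have hwy : dist (g w) (g y) ≤ 2 * R * (ε * t) + ε * t := by
    rcases hw' with h | h
    · have h5 := hslow u huG w h
      have h6 : dist (g y) (g u) ≤ ε * t := by
        calc dist (g y) (g u) ≤ Lg * (e * t) := (hg y u).trans (mul_le_mul_of_nonneg_left hu hLg)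
          _ = Lg * e * t := by ring
          _ ≤ ε * t := mul_le_mul_of_nonneg_right heL hy0.le
      have := dist_triangle (g w) (g u) (g y)
      rw [dist_comm (g w) (g u), dist_comm (g u) (g y)] at this
      linarith
    · have h5 : dist (g w) (g y) ≤ 2 * R * (ε * t) := by
        calc dist (g w) (g y) ≤ Lg * (R * (2 * (e * t))) := (hg w y).trans
              (mul_le_mul_of_nonneg_left ((shortcutDist_le_dist hη w y).trans h) hLg)
          _ = 2 * R * (Lg * e * t) := by ring
          _ ≤ 2 * R * (ε * t) := mul_le_mul_of_nonneg_left
              (mul_le_mul_of_nonneg_right heL hy0.le) (by linarith)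
      linarith
  have := dist_triangle4 (g x) (g z) (g w) (g y)
  linarith

/-- A map with the same oscillation as `f` on shortcuts has positive pointwise Lipschitz constant
at the non-porous points of subsets of `Bad_ε(f)`. -/
theorem lipAtWithin_pos_of_not_isPorousAt (hJ : ShortcutBounds J δ a a₀ b)
    (hη : ∀ i, 0 < η i ∧ η i ≤ 1) {f g : X → Y} (hg : IsLipschitz (shortcutDist J η) g)
    (hgf : ∀ i, ∀ S ∈ J i, ∀ z ∈ S, ∀ w ∈ S, dist (g z) (g w) = dist (f z) (f w))
    {ε : ℝ} (hε : 0 < ε) {A E : Set X} (hEA : E ⊆ A) {x : X} (hx : x ∈ badEps J δ η f ε)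
    (hpor : ¬ IsPorousAt (shortcutDist J η) E x) :
    0 < lipAtWithin (shortcutDist J η) A g x := by
  rw [pos_iff_ne_zero]
  intro hzero
  rw [lipAtWithin_eq_zero_iff] at hzero
  obtain ⟨L, hL, hg⟩ := hg
  have hη0 : ∀ i, 0 ≤ η i := fun i => (hη i).1.le
  have ha := hJ.a_pos
  -- With `t = η i * δ i`, every point of a large shortcut near `x` will be within `K * t` of `x`
  -- for `d_η`: `2 / ε` to reach the shortcut, `a` to cross it.
  set K := 2 / ε + a with hK
  have hK0 : 0 < K := by positivity
  obtain ⟨e, he, he1, heL⟩ : ∃ e : ℝ, 0 < e ∧ e ≤ 1 ∧ L * e * K ≤ ε / 16 := by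
    refine ⟨min 1 (ε / (16 * K * (L + 1))), lt_min one_pos (by positivity), min_le_left _ _, ?_⟩
    calc L * min 1 (ε / (16 * K * (L + 1))) * K
        ≤ (L + 1) * (ε / (16 * K * (L + 1))) * K := by
          gcongr
          · linarith
          · exact min_le_right _ _
      _ = ε / 16 := by field_simp
  obtain ⟨r₁, hr₁, hlip⟩ := hzero (ε / (32 * K)) (by positivity)
  obtain ⟨r₂, hr₂, hdense⟩ := exists_mem_of_not_isPorousAt (shortcutDist_nonneg hη0) hpor he
  have hev : ∀ᶠ i in atTop, 2 * K * δ i < min r₁ r₂ := by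
    have := hJ.tendsto.const_mul (2 * K)
    rw [mul_zero] at this
    exact this.eventually_lt_const (lt_min hr₁ hr₂)
  rw [badEps, mem_limsup_iff_frequently_mem] at hx
  obtain ⟨i, hxi, hi⟩ := (hx.and_eventually hev).exists
  set t := η i * δ i with ht
  have ht0 : 0 < t := mul_pos (hη i).1 (hJ.delta_pos i)
  have htδ : t ≤ δ i := mul_le_of_le_one_left (hJ.delta_pos i).le (hη i).2
  have hKt : 2 * K * t < min r₁ r₂ :=
    (mul_le_mul_of_nonneg_left htδ (by positivity)).trans_lt hi
  have hKt1 := hKt.trans_le (min_le_left _ _)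
  have hKt2 := hKt.trans_le (min_le_right _ _)
  have hKt0 : 0 < K * t := by positivity
  obtain ⟨s, hs, hsx⟩ : ∃ s ∈ ⋃₀ largeShortcuts J δ η f ε i,
      shortcutDist J η s x < 2 / ε * t := by
    have hlt : setDist (shortcutDist J η) (⋃₀ largeShortcuts J δ η f ε i) x <
        ENNReal.ofReal (2 / ε * t) := by
      refine lt_of_le_of_lt hxi ((ENNReal.ofReal_lt_ofReal_iff (by positivity)).2 ?_)
      rw [div_mul_eq_mul_div, div_lt_div_iff_of_pos_right hε]
      linarith
    simp only [setDist, iInf_lt_iff] at hlt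
    obtain ⟨s, hs, hsx⟩ := hlt
    exact ⟨s, hs, (ENNReal.ofReal_lt_ofReal_iff (by positivity)).1 hsx⟩
  obtain ⟨S, ⟨hS, hdiam⟩, hsS⟩ := hs
  obtain ⟨p, hp, q, hq, hpq⟩ : ∃ p ∈ S, ∃ q ∈ S, ε / 2 * t < dist (f p) (f q) := by
    by_contra! hcon
    have : Metric.diam (f '' S) ≤ ε / 2 * t := by
      refine Metric.diam_le_of_forall_dist_le (by positivity) ?_
      rintro _ ⟨p, hp, rfl⟩ _ ⟨q, hq, rfl⟩
      exact hcon p hp q hq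
    linarith [mul_pos hε ht0]
  rw [← hgf i S hS p hp q hq] at hpq
  have hnear : ∀ p ∈ S, dist (g x) (g p) ≤ ε / 8 * t := by
    intro p hp
    have h1 : shortcutDist J η x p ≤ K * t := by
      have h2 := shortcutDist_triangle hη0 (J := J) x s p
      rw [shortcutDist_symm x s] at h2
      have h3 := shortcutDist_le_of_mem hη0 hS hsS hp
      have h4 := mul_le_mul_of_nonneg_left (hJ.dist_le i S hS s hsS p hp) (hη i).1.le
      rw [hK, add_mul]
      linarith
    obtain ⟨p', hp', hpp⟩ := hdense p (by linarith)
    have h2 : shortcutDist J η p p' ≤ e * (K * t) :=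
      hpp.trans (mul_le_mul_of_nonneg_left h1 he.le)
    have h3 : e * (K * t) ≤ K * t := mul_le_of_le_one_left hKt0.le he1
    have h4 : shortcutDist J η x p' ≤ 2 * K * t := by
      linarith [shortcutDist_triangle hη0 (J := J) x p p']
    have h5 : dist (g x) (g p') ≤ ε / 16 * t := by
      rcases (shortcutDist_nonneg hη0 (J := J) x p').eq_or_lt with h0 | h0
      · have := hg x p'
        rw [← h0, mul_zero] at this
        exact this.trans (by positivity)
      · calc dist (g x) (g p') ≤ ε / (32 * K) * shortcutDist J η x p' :=
              hlip p' (hEA hp') h0 (by linarith)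
          _ ≤ ε / (32 * K) * (2 * K * t) := by gcongr
          _ = ε / 16 * t := by field_simp; norm_num
    have h6 : dist (g p) (g p') ≤ ε / 16 * t := by
      calc dist (g p) (g p') ≤ L * (e * (K * t)) := (hg p p').trans
            (mul_le_mul_of_nonneg_left h2 hL)
        _ = L * e * K * t := by ring
        _ ≤ ε / 16 * t := mul_le_mul_of_nonneg_right heL ht0.le
    linarith [dist_triangle_right (g x) (g p) (g p')]
  linarith [dist_triangle_left (g p) (g q) (g x), hnear p hp, hnear q hq, mul_pos hε ht0]

end Bad

/-! ### Almost everywhere statements -/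

section AlmostEverywhere

variable {X : Type*} [MetricSpace X] {Y : Type*} [NormedAddCommGroup Y] [NormedSpace ℝ Y]
  {J : ℕ → Set (Set X)} {δ η : ℕ → ℝ} {a a₀ b : ℝ}

/-- A differential with respect to `d` is one with respect to `d_η` as soon as it approximates
`f` to first order with respect to `d_η`. -/
theorem IsCheegerDifferential.to_shortcutDist (hη : ∀ i, 0 < η i ∧ η i ≤ 1) {n : ℕ}
    {φ : X → EuclideanSpace ℝ (Fin n)} {f : X → Y} (hf : IsLipschitz (shortcutDist J η) f)
    (hφ : IsLipschitz (shortcutDist J η) φ) {x : X}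
    {T : EuclideanSpace ℝ (Fin n) →ₗ[ℝ] Y} (hT : IsCheegerDifferential dist φ f x T)
    (h : lipAt (shortcutDist J η) (fun y => f y - T (φ y)) x = 0) :
    IsCheegerDifferential (shortcutDist J η) φ f x T := by
  refine ⟨h, fun T' hT' => hT.2 T' ?_⟩
  have hη0 : ∀ i, 0 ≤ η i := fun i => (hη i).1.le
  rw [lipAtWithin_eq_zero_iff] at hT' ⊢
  intro ε hε
  obtain ⟨r, hr, h⟩ := hT' ε hε
  refine ⟨r, hr, fun y hy h0 h1 => ?_⟩
  have hle := shortcutDist_le_dist (J := J) hη x y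
  -- Points at `d_η`-distance zero from `x` are invisible to the limsup; there the Lipschitz bound
  -- gives equal values.
  rcases (shortcutDist_nonneg hη0 (J := J) x y).eq_or_lt with he | he
  · obtain ⟨L, hL, hg⟩ := hf.sub_linear_comp hφ T'
    have := hg x y
    rw [← he, mul_zero] at this
    exact this.trans (by positivity)
  · exact (h y hy he (hle.trans_lt h1)).trans (mul_le_mul_of_nonneg_left hle hε.le)

/-- Almost everywhere outside `Bad(f)`, a differential of `f` with respect to `d` is also one with
respect to `d_η`. -/
theorem ae_isCheegerDifferential_shortcutDist [TopologicalSpace.SeparableSpace X]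
    [MeasurableSpace X] {μ : Measure X} (hJ : ShortcutBounds J δ a a₀ b)
    (hη : ∀ i, 0 < η i ∧ η i ≤ 1)
    (hpor : ∀ E : Set X, IsPorous (shortcutDist J η) E → μ E = 0)
    {f : X → Y} (hf : IsLipschitz (shortcutDist J η) f) {n : ℕ}
    {φ : X → EuclideanSpace ℝ (Fin n)} (hφ : IsLipschitz dist φ)
    (hconst : ∀ i, ∀ S ∈ J i, ∀ x ∈ S, ∀ y ∈ S, dist (φ x) (φ y) = 0) :
    ∀ᵐ x ∂μ, x ∉ bad J δ η f → ∀ T, IsCheegerDifferential dist φ f x T →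
      IsCheegerDifferential (shortcutDist J η) φ f x T := by
  have hη0 : ∀ i, 0 ≤ η i := fun i => (hη i).1.le
  have hφη := hφ.shortcutDist_of_const hconst hη0
  have hfc : Continuous f := by
    obtain ⟨L, hL, h⟩ := hf
    refine (LipschitzWith.of_dist_le_mul (K := L.toNNReal) fun x y => ?_).continuous
    rw [Real.coe_toNNReal _ hL]
    exact (h x y).trans (mul_le_mul_of_nonneg_left (shortcutDist_le_dist hη x y) hL)
  obtain ⟨𝒯, h𝒯, happrox⟩ := exists_countable_approx_differential hfc n
  obtain ⟨K, hK, hbound⟩ := exists_lipschitz_bound_of_notMem_bad hJ hη hf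
  obtain ⟨Lφ, hLφ, hφL⟩ := hφη
  have hae : ∀ᵐ x ∂μ, ∀ T₀ ∈ 𝒯, ∀ k m : ℕ,
      x ∈ slowSet (fun y => f y - T₀ (φ y)) (1 / ((k : ℝ) + 1)) (1 / ((m : ℝ) + 1)) →
      ¬ IsPorousAt (shortcutDist J η)
        (slowSet (fun y => f y - T₀ (φ y)) (1 / ((k : ℝ) + 1)) (1 / ((m : ℝ) + 1))) x := by
    rw [ae_ball_iff h𝒯]
    intro T₀ _
    rw [ae_all_iff]
    intro k
    rw [ae_all_iff]
    intro m
    rw [ae_iff]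
    refine measure_mono_null ?_ (hpor _ (isPorous_porousPoints _
      (slowSet (fun y => f y - T₀ (φ y)) (1 / ((k : ℝ) + 1)) (1 / ((m : ℝ) + 1)))))
    intro x hx
    simpa using hx
  filter_upwards [hae] with x hx hbad T hT
  refine hT.to_shortcutDist hη hf ⟨Lφ, hLφ, hφL⟩ (lipAtWithin_eq_zero_iff.2 fun ε hε => ?_)
  obtain ⟨k, hk⟩ := exists_nat_one_div_lt (show 0 < ε / (2 * K) by positivity)
  set εk : ℝ := 1 / ((k : ℝ) + 1) with hεk
  have hεk0 : 0 < εk := by positivity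
  obtain ⟨Ld, hLd, hφd⟩ := hφ
  -- The first tolerance puts `x` in the slow set of `f - T₀ ∘ φ` for `d`; the second returns from
  -- `T₀` to `T` for `d_η`.
  obtain ⟨T₀, hT₀, hTT⟩ := happrox dist φ x T hT
    (min (εk / (2 * (Ld + 1))) (ε / (2 * (Lφ + 1)))) (lt_min (by positivity) (by positivity))
  have hdiff : ∀ y, ‖(T - T₀) (φ x - φ y)‖ ≤
      min (εk / (2 * (Ld + 1))) (ε / (2 * (Lφ + 1))) * dist (φ x) (φ y) := fun y => by
    rw [dist_eq_norm]; exact hTT _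
  obtain ⟨r₁, hr₁, hlip⟩ := lipAtWithin_eq_zero_iff.1 hT.1 (εk / 2) (by positivity)
  obtain ⟨m, hm⟩ := exists_nat_one_div_lt hr₁
  have hslow : x ∈ slowSet (fun y => f y - T₀ (φ y)) εk (1 / ((m : ℝ) + 1)) := by
    intro y hy
    rcases (dist_nonneg (x := x) (y := y)).eq_or_lt with h0 | h0
    · rw [eq_of_dist_eq_zero h0.symm]
      simp
    have h1 := hlip y (mem_univ _) h0 (hy.trans hm)
    have h2 : ‖(T - T₀) (φ x - φ y)‖ ≤ εk / 2 * dist x y := by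
      calc ‖(T - T₀) (φ x - φ y)‖ ≤ εk / (2 * (Ld + 1)) * ((Ld + 1) * dist x y) := by
            refine (hdiff y).trans ?_
            gcongr
            · exact min_le_left _ _
            · linarith [hφd x y]
        _ = εk / 2 * dist x y := by field_simp
    have h3 : f x - T₀ (φ x) - (f y - T₀ (φ y)) =
        (f x - T (φ x) - (f y - T (φ y))) + (T - T₀) (φ x - φ y) := by
      simp only [LinearMap.sub_apply, map_sub]
      abel
    rw [dist_eq_norm] at h1 ⊢
    rw [h3]
    refine (norm_add_le _ _).trans ?_
    linarith
  have hgf : ∀ i, ∀ S ∈ J i, ∀ z ∈ S, ∀ w ∈ S,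
      dist (f z - T₀ (φ z)) (f w - T₀ (φ w)) = dist (f z) (f w) := by
    intro i S hS z hz w hw
    rw [eq_of_dist_eq_zero (hconst i S hS z hz w hw), dist_sub_right]
  obtain ⟨r, hr, hfin⟩ := hbound _
    (hf.sub_linear_comp ⟨Lφ, hLφ, hφL⟩ T₀) hgf εk _ hεk0
    Nat.one_div_pos_of_nat x hbad hslow (hx T₀ hT₀ k m hslow)
  refine ⟨r, hr, fun y _ h0 h1 => ?_⟩
  have h2 := hfin y h0 h1
  have h3 : ‖(T - T₀) (φ x - φ y)‖ ≤ ε / 2 * shortcutDist J η x y := by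
    calc ‖(T - T₀) (φ x - φ y)‖ ≤ ε / (2 * (Lφ + 1)) * ((Lφ + 1) * shortcutDist J η x y) := by
          refine (hdiff y).trans ?_
          gcongr
          · exact min_le_right _ _
          · linarith [hφL x y]
      _ = ε / 2 * shortcutDist J η x y := by field_simp
  have h4 : K * εk ≤ ε / 2 := by
    rw [lt_div_iff₀ (by positivity)] at hk
    linarith
  have h5 := mul_le_mul_of_nonneg_right h4 h0.le
  have h6 : f x - T (φ x) - (f y - T (φ y)) =
      (f x - T₀ (φ x) - (f y - T₀ (φ y))) - (T - T₀) (φ x - φ y) := by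
    simp only [LinearMap.sub_apply, map_sub]
    abel
  rw [dist_eq_norm] at h2 ⊢
  rw [h6]
  refine (norm_sub_le _ _).trans ?_
  linarith

/-- Almost everywhere in a subset of `Bad(f)`, no linear map approximates `f` to first order. -/
theorem ae_lipAtWithin_pos_of_subset_bad [MeasurableSpace X] {μ : Measure X}
    (hJ : ShortcutBounds J δ a a₀ b) (hη : ∀ i, 0 < η i ∧ η i ≤ 1)
    (hpor : ∀ E : Set X, IsPorous (shortcutDist J η) E → μ E = 0)
    {f : X → Y} (hf : IsLipschitz (shortcutDist J η) f) {n : ℕ}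
    {φ : X → EuclideanSpace ℝ (Fin n)} (hφ : IsLipschitz dist φ)
    (hconst : ∀ i, ∀ S ∈ J i, ∀ x ∈ S, ∀ y ∈ S, dist (φ x) (φ y) = 0)
    {A : Set X} (hA : A ⊆ bad J δ η f) :
    ∀ᵐ x ∂μ, x ∈ A → ∀ T : EuclideanSpace ℝ (Fin n) →ₗ[ℝ] Y,
      0 < lipAtWithin (shortcutDist J η) A (fun y => f y - T (φ y)) x := by
  have hη0 : ∀ i, 0 ≤ η i := fun i => (hη i).1.le
  have hφη := hφ.shortcutDist_of_const hconst hη0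
  have hae : ∀ᵐ x ∂μ, ∀ k : ℕ, x ∈ A ∩ badEps J δ η f (1 / ((k : ℝ) + 1)) →
      ¬ IsPorousAt (shortcutDist J η) (A ∩ badEps J δ η f (1 / ((k : ℝ) + 1))) x := by
    rw [ae_all_iff]
    intro k
    rw [ae_iff]
    refine measure_mono_null ?_ (hpor _ (isPorous_porousPoints _
      (A ∩ badEps J δ η f (1 / ((k : ℝ) + 1)))))
    intro x hx
    rwa [mem_ofPred_eq, Classical.not_imp, not_not] at hx
  filter_upwards [hae] with x hx hxA T
  obtain ⟨ε, hε, hxε⟩ := mem_iUnion₂.1 (hA hxA)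
  obtain ⟨k, hk⟩ := exists_nat_one_div_lt hε
  have hxk := badEps_anti hJ.delta_pos (fun i => (hη i).1) f Nat.one_div_pos_of_nat hk.le hxε
  refine lipAtWithin_pos_of_not_isPorousAt hJ hη
    (hf.sub_linear_comp hφη T) (fun i S hS z hz w hw => ?_)
    Nat.one_div_pos_of_nat inter_subset_left hxk (hx k ⟨hxA, hxk⟩)
  rw [eq_of_dist_eq_zero (hconst i S hS z hz w hw), dist_sub_right]

end AlmostEverywhere

end Shortcut

theorem mainTheorem4 {X : Type*} [MetricSpace X] [MeasurableSpace X]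
    {Y : Type*} [NormedAddCommGroup Y] [NormedSpace ℝ Y] [CompleteSpace Y]
    (μ : Measure X) (J : ℕ → Set (Set X)) (δ η : ℕ → ℝ)
    (hη : ∀ i, 0 < η i ∧ η i ≤ 1)
    (hX : Shortcut.IsLDSWithCompatibleShortcuts Y μ J δ)
    (hpor : ∀ E : Set X, Shortcut.IsPorous (Shortcut.shortcutDist J η) E → μ E = 0)
    (f : X → Y) (hf : Shortcut.IsLipschitz (Shortcut.shortcutDist J η) f)
    (𝒜 : Shortcut.ChartFamily X) (h𝒜 : Shortcut.IsCompatibleAtlas Y μ J 𝒜) :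
    -- differentiability almost everywhere outside `Bad(f)`
    (∀ j, ∀ᵐ x ∂μ, x ∈ 𝒜.U j \ Shortcut.bad J δ η f →
      ∃ T, Shortcut.IsCheegerDifferential (Shortcut.shortcutDist J η) (𝒜.φ j) f x T) ∧
    -- for every subset `A` of `Bad(f)`, at almost every point of `A` neither `f` nor its
    -- restriction to `(A, d_η)` is differentiable
    (∀ A ⊆ Shortcut.bad J δ η f, ∀ j, ∀ᵐ x ∂μ, x ∈ A ∩ 𝒜.U j →
      (∀ T : EuclideanSpace ℝ (Fin (𝒜.dim j)) →ₗ[ℝ] Y,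
        0 < Shortcut.lipAt (Shortcut.shortcutDist J η) (fun y => f y - T (𝒜.φ j y)) x) ∧
      (∀ T : EuclideanSpace ℝ (Fin (𝒜.dim j)) →ₗ[ℝ] Y,
        0 < Shortcut.lipAtWithin (Shortcut.shortcutDist J η) A
          (fun y => f y - T (𝒜.φ j y)) x)) ∧
    -- the differentials with respect to `d` and `d_η` agree almost everywhere outside `Bad(f)`
    (∀ j, ∀ᵐ x ∂μ, x ∈ 𝒜.U j \ Shortcut.bad J δ η f →
      ∃ T, Shortcut.IsCheegerDifferential dist (𝒜.φ j) f x T ∧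
        Shortcut.IsCheegerDifferential (Shortcut.shortcutDist J η) (𝒜.φ j) f x T) := by
  obtain ⟨⟨⟨-, hsep, -, -⟩, -⟩, hshort, -⟩ := hX
  obtain ⟨⟨-, hφ, -, hdiff⟩, hcompat⟩ := h𝒜
  obtain ⟨a, a₀, b, hJ⟩ := hshort.exists_bounds
  have hconst : ∀ j, ∀ i, ∀ S ∈ J i, ∀ x ∈ S, ∀ y ∈ S, dist (𝒜.φ j x) (𝒜.φ j y) = 0 := by
    intro j i S hS x hx y hy
    refine le_antisymm ?_ dist_nonneg
    rw [← hcompat j i S hS]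
    exact Metric.dist_le_diam_of_mem ((hJ.finite i S hS).image _).isBounded
      (mem_image_of_mem _ hx) (mem_image_of_mem _ hy)
  -- Since `d_η ≤ d`, the atlas provides differentials of `f` with respect to `d`.
  have hf' : Shortcut.IsLipschitz dist f := by
    obtain ⟨L, hL, h⟩ := hf
    exact ⟨L, hL, fun x y => (h x y).trans
      (mul_le_mul_of_nonneg_left (Shortcut.shortcutDist_le_dist hη x y) hL)⟩
  have hagree : ∀ j, ∀ᵐ x ∂μ, x ∈ 𝒜.U j \ Shortcut.bad J δ η f →
      ∃ T, Shortcut.IsCheegerDifferential dist (𝒜.φ j) f x T ∧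
        Shortcut.IsCheegerDifferential (Shortcut.shortcutDist J η) (𝒜.φ j) f x T := by
    intro j
    filter_upwards [hdiff f hf' j, Shortcut.ae_isCheegerDifferential_shortcutDist hJ hη hpor hf
      (hφ j) (hconst j)] with x h1 h2 hx
    obtain ⟨T, hT⟩ := h1 hx.1
    exact ⟨T, hT, h2 hx.2 T hT⟩
  refine ⟨fun j => ?_, fun A hA j => ?_, hagree⟩
  · filter_upwards [hagree j] with x h hx
    obtain ⟨T, -, hT⟩ := h hx
    exact ⟨T, hT⟩
  · filter_upwards [Shortcut.ae_lipAtWithin_pos_of_subset_bad hJ hη hpor hf (hφ j) (hconst j) hA]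
      with x h hx
    exact ⟨fun T => (h hx.1 T).trans_le (Shortcut.lipAtWithin_mono (subset_univ A) _ x), h hx.1⟩
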